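/- Let $X$ be a Grothendieck category (an abelian category with a generator in which small filtered colimits exist and are exact); all subcategories of $X$ are full. A subcategory is *weakly closed* if it is closed under subobjects, quotient objects and small direct sums, and *localizing* if it is moreover closed under extensions. Let $Y$ be a localizing subcategory of $X$, let $\pi\colon X\to X/Y$ be the quotient functor (the localization of $X$ at the morphisms whose kernel and cokernel lie in $Y$), and let $\omega\colon X/Y\to X$ be its right adjoint. An object is *$Y$-torsionfree* if it has no nonzero subobject in $Y$. For a subcategory $W$ of $X$: - $W'$ denotes the subcategory generated by the $Y$-torsionfree objects in $W$, that is, the subcategory of all epimorphic images of small direct sums of $Y$-torsionfree objects belonging to $W$; - $\pi^{-1}(\pi(W))$ denotes the subcategory of all objects $M$ of $X$ such that $\pi(M)\cong\pi(N)$ for some $N\in W$; - $W$ is *$Y$-essentially stable* if $\omega\pi(M)\in W$ for every $M\in W$. For subcategories $V,W$ of $X$, the *Gabriel product* $V*W$ is the subcategory of all objects $P$ for which there is a short exact sequence $0\to M\to P\to N\to 0$ with $M\in W$ and $N\in V$. Let $Z$ be a weakly closed subcategory of $X$. Then: 1. $(\pi^{-1}(\pi(Z)))'=(Y*Z)'$.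 2. The following are equivalent: (i) $Z$ is $Y$-essentially stable; (ii) $Z'=(\pi^{-1}(\pi(Z)))'$; (iii) $Y*Z\subseteq Z*Y$. -/

import Mathlib

open CategoryTheory CategoryTheory.Limits

universe v u v' u'

namespace QuotientCat

section Definitions

set_option linter.unusedSectionVars false

variable {C : Type u} [Category.{v} C] [Abelian C]

/-- A full subcategory of `C`, given by a property of objects, is *weakly closed* if it is closed
under subobjects, quotient objects and small direct sums. -/
class IsWeaklyClosed (Z : ObjectProperty C) : Prop extends
    Z.IsClosedUnderSubobjects, Z.IsClosedUnderQuotients where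
  closedUnderDirectSums (ι : Type v) : Z.IsClosedUnderColimitsOfShape (Discrete ι)

/-- A *localizing* subcategory is a weakly closed subcategory which is closed under extensions. -/
class IsLocalizing (Y : ObjectProperty C) : Prop extends
    IsWeaklyClosed Y, Y.IsClosedUnderExtensions

/-- `M` is `Y`-torsionfree: its largest subobject belonging to `Y` is zero, that is, every
subobject of `M` belonging to `Y` is zero. -/
def IsTorsionfree (Y : ObjectProperty C) (M : C) : Prop :=
  ∀ ⦃T : C⦄ (i : T ⟶ M) [Mono i], Y T → IsZero T

/-- The full subcategory generated by the objects in `P`: the objects which are epimorphic images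
of small direct sums of objects in `P`. -/
def generatedBy [HasCoproducts.{v} C] (P : ObjectProperty C) : ObjectProperty C := fun M =>
  ∃ (ι : Type v) (K : ι → C) (f : (∐ K) ⟶ M), (∀ i, P (K i)) ∧ Epi f

/-- The subcategory `Z'` generated by the `Y`-torsionfree objects in `Z`. -/
def torsionfreePart [HasCoproducts.{v} C] (Y Z : ObjectProperty C) : ObjectProperty C :=
  generatedBy (fun M => Z M ∧ IsTorsionfree Y M)

/-- The Gabriel product `Z * W`: the objects `P` that sit in a short exact sequence
`0 ⟶ M ⟶ P ⟶ N ⟶ 0` with `M` in `W` and `N` in `Z`. -/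
def gabrielProduct (Z W : ObjectProperty C) : ObjectProperty C := fun P =>
  ∃ (M N : C) (f : M ⟶ P) (g : P ⟶ N) (w : f ≫ g = 0),
    (ShortComplex.mk f g w).ShortExact ∧ W M ∧ Z N

lemma IsWeaklyClosed.prop_sigma [HasCoproducts.{v} C] (Z : ObjectProperty C) [IsWeaklyClosed Z]
    {ι : Type v} (K : ι → C) (h : ∀ i, Z (K i)) : Z (∐ K) := by
  have := IsWeaklyClosed.closedUnderDirectSums (Z := Z) ι
  exact Z.prop_colimit _ (fun ⟨j⟩ => h j)

instance IsWeaklyClosed.containsZero (Z : ObjectProperty C) [IsWeaklyClosed Z] :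
    Z.ContainsZero := by
  have := IsWeaklyClosed.closedUnderDirectSums (Z := Z) PEmpty
  let e := Discrete.equivalence (Equiv.equivPEmpty PEmpty.{v + 1} : PEmpty.{v + 1} ≃ PEmpty.{1})
  have := (Z.isClosedUnderColimitsOfShape_iff_of_equivalence e).1 this
  obtain ⟨O, hO⟩ := HasZeroObject.zero (C := C)
  exact ⟨O, hO, Z.prop_of_isInitial O hO.isInitial⟩

/-- A localizing subcategory is a Serre class, so that the quotient category by it makes sense:
it is the localization of `C` at the class `Y.isoModSerre` of all morphisms with kernel and
cokernel in `Y`. -/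
instance IsLocalizing.isSerreClass (Y : ObjectProperty C) [IsLocalizing Y] :
    Y.IsSerreClass where

end Definitions

/-! ### Existence of the section functor -/

section SectionFunctor

set_option linter.unusedSectionVars false

variable {C : Type u} [Category.{v} C] [Abelian C] {Y : ObjectProperty C}

lemma IsTorsionfree.eq_zero [IsLocalizing Y] {M T : C} (hM : IsTorsionfree Y M) (hT : Y T)
    (f : T ⟶ M) : f = 0 := by
  have h : Y (image f) := Y.prop_of_epi (factorThruImage f) hT
  rw [← image.fac f, (hM (image.ι f) h).eq_of_tgt (factorThruImage f) 0, zero_comp]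

lemma IsTorsionfree.of_mono {M N : C} (hN : IsTorsionfree Y N) (f : M ⟶ N) [Mono f] :
    IsTorsionfree Y M := fun _ i _ hT => hN (i ≫ f) hT

lemma prop_of_prop_kernel [IsLocalizing Y] {P S : C} (f : P ⟶ S) (hK : Y (kernel f)) (hS : Y S) :
    Y P :=
  Y.prop_X₂_of_exact (ShortComplex.exact_kernel f) hK hS

lemma mono_monoLift {A M T : C} (i : T ⟶ M) [Mono i] (f : A ⟶ M) [Mono f]
    (hf : f ≫ cokernel.π i = 0) : Mono (Abelian.monoLift i f hf) := by
  have : Mono (Abelian.monoLift i f hf ≫ i) := by rwa [Abelian.monoLift_comp]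
  exact mono_of_mono _ i

variable [IsGrothendieckAbelian.{v} C]

lemma exists_torsion [IsLocalizing Y] (M : C) :
    ∃ (T : C) (i : T ⟶ M), Mono i ∧ Y T ∧ IsTorsionfree Y (cokernel i) := by
  let J := Shrink.{v} {S : Subobject M // Y (S : C)}
  let S (j : J) : Subobject M := ((equivShrink _).symm j).1
  have hS (j : J) : Y (S j : C) := ((equivShrink _).symm j).2
  let f : (∐ fun j => (S j : C)) ⟶ M := Sigma.desc fun j => (S j).arrow
  have key {P : C} (p : P ⟶ M) [Mono p] (hP : Y P) : p ≫ cokernel.π (image.ι f) = 0 := by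
    have h1 : Y ((Subobject.mk p : Subobject M) : C) :=
      Y.prop_of_iso (Subobject.underlyingIso p).symm hP
    let j : J := equivShrink _ ⟨Subobject.mk p, h1⟩
    have hj : S j = Subobject.mk p := by simp [S, j]
    have h2 : (S j).arrow ≫ cokernel.π (image.ι f) = 0 := by
      have : (S j).arrow = Sigma.ι (fun j => (S j : C)) j ≫ f := by simp [f]
      rw [this, Category.assoc, ← image.fac_assoc f, cokernel.condition, comp_zero, comp_zero]
    rw [hj] at h2
    rw [← Subobject.underlyingIso_hom_comp_eq_mk] at h2
    rwa [Category.assoc, ← cancel_epi (Subobject.underlyingIso p).inv, Iso.inv_hom_id_assoc,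
      comp_zero] at h2
  have hT : Y (image f) := Y.prop_of_epi (factorThruImage f) (IsWeaklyClosed.prop_sigma Y _ hS)
  refine ⟨image f, image.ι f, inferInstance, hT, ?_⟩
  intro P t _ hP
  let p := pullback.fst (cokernel.π (image.ι f)) t
  let s := pullback.snd (cokernel.π (image.ι f)) t
  have hker : (kernel.ι s ≫ p) ≫ cokernel.π (image.ι f) = 0 := by
    rw [Category.assoc, pullback.condition, kernel.condition_assoc, zero_comp]
  have hK : Y (kernel s) := by
    have : Mono (kernel.ι s ≫ p) := inferInstance
    have hm : Mono (Abelian.monoLift (image.ι f) (kernel.ι s ≫ p) hker) := by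
      exact mono_monoLift (image.ι f) (kernel.ι s ≫ p) hker
    exact Y.prop_of_mono (Abelian.monoLift (image.ι f) (kernel.ι s ≫ p) hker) hT
  have h0 := key p (prop_of_prop_kernel s hK hP)
  rw [pullback.condition] at h0
  have : t = 0 := by
    rw [← cancel_epi (pullback.snd (cokernel.π (image.ι f)) t), h0, comp_zero]
  exact IsZero.of_mono_eq_zero t this

lemma mono_comp_iff [IsLocalizing Y] {I T F : C} (i : T ⟶ I) [Mono i] (hT : Y T)
    (hi : IsTorsionfree Y (cokernel i)) (e : F ⟶ I) [Mono e] :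
    Mono (e ≫ cokernel.π i) ↔ IsTorsionfree Y F := by
  refine ⟨fun _ => hi.of_mono (e ≫ cokernel.π i), fun hF => ?_⟩
  have hker : (kernel.ι (e ≫ cokernel.π i) ≫ e) ≫ cokernel.π i = 0 := by
    rw [Category.assoc, kernel.condition]
  have hm : Mono (Abelian.monoLift i (kernel.ι (e ≫ cokernel.π i) ≫ e) hker) :=
    mono_monoLift i _ hker
  have h0 := hF (kernel.ι (e ≫ cokernel.π i))
    (Y.prop_of_mono (Abelian.monoLift i (kernel.ι (e ≫ cokernel.π i) ≫ e) hker) hT)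
  exact Preadditive.mono_of_kernel_zero (h0.eq_of_src _ _)

lemma exists_maximal_mono {I Q : C} (q : I ⟶ Q) (E₀ : Subobject I) (h₀ : Mono (E₀.arrow ≫ q)) :
    ∃ E : Subobject I, E₀ ≤ E ∧ Maximal (fun E => Mono (E.arrow ≫ q)) E := by
  refine zorn_le_nonempty₀ {E : Subobject I | Mono (E.arrow ≫ q)} ?_ E₀ h₀
  intro c hc hchain y hy
  obtain ⟨J, ⟨e⟩⟩ := (inferInstance : Small.{v} c).equiv_small
  let S (j : J) : Subobject I := (e.symm j).1
  have hS (j : J) : Mono ((S j).arrow ≫ q) := hc (e.symm j).2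
  let : Preorder J := Preorder.lift S
  have : IsDirectedOrder J := ⟨fun a b => by
    rcases hchain.total (e.symm a).2 (e.symm b).2 with h | h
    · exact ⟨b, h, le_refl (S b)⟩
    · exact ⟨a, le_refl (S a), h⟩⟩
  have : Nonempty J := ⟨e ⟨y, hy⟩⟩
  have : IsFiltered J := isFiltered_of_directed_le_nonempty J
  have hST {a b : J} (h : a ≤ b) : S a ≤ S b := h
  let F : J ⥤ C :=
    { obj j := (S j : C)
      map {a b} h := Subobject.ofLE (S a) (S b) (hST (leOfHom h)) }
  let φ : F ⟶ (Functor.const _).obj I := { app j := (S j).arrow }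
  have hφ : Mono φ := by
    have (j : J) : Mono (φ.app j) := by dsimp [φ]; infer_instance
    exact NatTrans.mono_of_mono_app φ
  let ψ : F ⟶ (Functor.const _).obj Q := { app j := (S j).arrow ≫ q }
  have hψ : Mono ψ := by
    have (j : J) : Mono (ψ.app j) := hS j
    exact NatTrans.mono_of_mono_app ψ
  have := IsFiltered.isConnected J
  let f : colimit F ⟶ I := colimit.desc F (Cocone.mk I φ)
  have hιf (j : J) : colimit.ι F j ≫ f = (S j).arrow := colimit.ι_desc _ _
  have hf : Mono f := colim.map_mono' φ (colimit.isColimit F) (isColimitConstCocone J I) f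
    (fun j => (hιf j).trans (Category.comp_id _).symm)
  have hfq : Mono (f ≫ q) := colim.map_mono' ψ (colimit.isColimit F) (isColimitConstCocone J Q)
    (f ≫ q) (fun j => ((reassoc_of% hιf j) q).trans (Category.comp_id _).symm)
  refine ⟨Subobject.mk f, ?_, ?_⟩
  · change Mono _
    rw [← Subobject.underlyingIso_hom_comp_eq_mk, Category.assoc]
    infer_instance
  · intro z hz
    have hj : S (e ⟨z, hz⟩) = z := by simp [S]
    rw [← hj]
    exact Subobject.le_mk_of_comm (colimit.ι F _) (hιf _)

/-- `E` has the extension property for monomorphisms with cokernel in `Y`. -/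
def IsExtensive (Y : ObjectProperty C) (E : C) : Prop :=
  ∀ ⦃A B : C⦄ (i : A ⟶ B) [Mono i], Y (cokernel i) → ∀ g : A ⟶ E, ∃ h : B ⟶ E, i ≫ h = g

lemma exists_extensive [IsLocalizing Y] {M : C} (hM : IsTorsionfree Y M) :
    ∃ (E : C) (j : M ⟶ E), Mono j ∧ IsTorsionfree Y E ∧ IsExtensive Y E := by
  let e := Injective.ι M
  obtain ⟨T, i, _, hT, hi⟩ := exists_torsion (Y := Y) (Injective.under M)
  have h₀ : Mono ((Subobject.mk e).arrow ≫ cokernel.π i) :=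
    (mono_comp_iff i hT hi _).2 (hM.of_mono (Subobject.underlyingIso e).hom)
  obtain ⟨E, hE₀, hE⟩ := exists_maximal_mono (cokernel.π i) _ h₀
  have hEt : IsTorsionfree Y (E : C) := (mono_comp_iff i hT hi _).1 hE.prop
  refine ⟨(E : C), Subobject.ofMkLE e E hE₀, inferInstance, hEt, ?_⟩
  intro A B a _ ha g
  obtain ⟨T', t, _, hT', ht⟩ := exists_torsion (Y := Y) (pushout a g)
  let k : (E : C) ⟶ cokernel t := pushout.inr a g ≫ cokernel.π t
  have hk : Mono k := (mono_comp_iff t hT' ht _).2 hEt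
  have hck : Y (cokernel k) := by
    let φ : cokernel a ⟶ cokernel k :=
      cokernel.desc a (pushout.inl a g ≫ cokernel.π t ≫ cokernel.π k) (by
        rw [pushout.condition_assoc]
        have := cokernel.condition k
        simp only [k, Category.assoc] at this
        rw [this, comp_zero])
    have hφ : Epi φ := ⟨fun x y hxy => by
      rw [← cancel_epi (cokernel.π k), ← cancel_epi (cokernel.π t)]
      apply pushout.hom_ext
      · have := cokernel.π a ≫= hxy
        simpa [φ] using this
      · have := cokernel.condition k
        simp only [k, Category.assoc] at this
        rw [reassoc_of% this, reassoc_of% this, zero_comp, zero_comp]⟩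
    exact Y.prop_of_epi φ ha
  let m : cokernel t ⟶ Injective.under M := Injective.factorThru E.arrow k
  have hkm : k ≫ m = E.arrow := Injective.comp_factorThru _ _
  have hm : Mono m := by
    have hp : Mono (kernel.ι m ≫ cokernel.π k) := by
      refine Preadditive.mono_of_cancel_zero _ (fun {L} x hx => ?_)
      rw [← Category.assoc] at hx
      have h1 : Abelian.monoLift k (x ≫ kernel.ι m) hx = 0 := by
        rw [← cancel_mono E.arrow, ← hkm, ← Category.assoc, Abelian.monoLift_comp]
        simp
      rw [← cancel_mono (kernel.ι m), ← Abelian.monoLift_comp k (x ≫ kernel.ι m) hx, h1]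
      simp
    exact Preadditive.mono_of_kernel_zero
      ((ht (kernel.ι m) (Y.prop_of_mono (kernel.ι m ≫ cokernel.π k) hck)).eq_of_src _ _)
  have hmq : Mono ((Subobject.mk m).arrow ≫ cokernel.π i) :=
    (mono_comp_iff i hT hi _).2 (ht.of_mono (Subobject.underlyingIso m).hom)
  have hle : Subobject.mk m ≤ E := hE.2 hmq (Subobject.le_mk_of_comm k hkm)
  let r : cokernel t ⟶ (E : C) := Subobject.ofMkLE m E hle
  have hkr : k ≫ r = 𝟙 _ := by
    rw [← cancel_mono E.arrow, Category.assoc, Subobject.ofMkLE_arrow, hkm, Category.id_comp]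
  refine ⟨pushout.inl a g ≫ cokernel.π t ≫ r, ?_⟩
  rw [pushout.condition_assoc]
  simp only [k, Category.assoc] at hkr
  rw [hkr, Category.comp_id]

lemma IsTorsionfree.isLocal [IsLocalizing Y] {N : C} (hN : IsTorsionfree Y N)
    (hN' : IsExtensive Y N) : Y.isoModSerre.isLocal N := by
  rintro A B s ⟨hs, hs'⟩
  constructor
  · intro f g hfg
    have h : s ≫ (f - g) = 0 := by
      rw [Preadditive.comp_sub, sub_eq_zero]
      exact hfg
    have h1 := hN.eq_zero hs' (cokernel.desc s (f - g) h)
    have h2 : f - g = 0 := by rw [← cokernel.π_desc s (f - g) h, h1, comp_zero]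
    exact sub_eq_zero.1 h2
  · intro g
    have h0 : kernel.ι s ≫ g = 0 := hN.eq_zero hs _
    have hc : Y (cokernel (Abelian.image.ι s)) := by
      have : Epi (cokernel.desc s (cokernel.π (Abelian.image.ι s)) (by
          have := cokernel.condition (Abelian.image.ι s)
          have h2 := Abelian.factorThruImage s ≫= this
          rwa [comp_zero, ← Category.assoc, Abelian.image.fac] at h2)) := epi_of_epi_fac (cokernel.π_desc s _ _)
      exact Y.prop_of_epi (cokernel.desc s (cokernel.π (Abelian.image.ι s)) _) hs'
    have h0' : kernel.ι (Abelian.factorThruImage s) ≫ g = 0 := by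
      have : kernel.ι (Abelian.factorThruImage s) ≫ s = 0 := by
        have := Abelian.image.fac s
        have h2 := kernel.condition_assoc (Abelian.factorThruImage s) (Abelian.image.ι s)
        rwa [this, zero_comp] at h2
      rw [← kernel.lift_ι s _ this, Category.assoc, h0, comp_zero]
    obtain ⟨h, hh⟩ := hN' (Abelian.image.ι s) hc
      (Abelian.epiDesc (Abelian.factorThruImage s) g h0')
    refine ⟨h, ?_⟩
    change s ≫ h = g
    rw [← Abelian.image.fac s, Category.assoc, hh, Abelian.comp_epiDesc]

lemma exists_local [IsLocalizing Y] (M : C) :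
    ∃ (N : C) (u : M ⟶ N), Y.isoModSerre u ∧ Y.isoModSerre.isLocal N := by
  obtain ⟨T, t, _, hT, ht⟩ := exists_torsion (Y := Y) M
  obtain ⟨E, j, _, hE, hE'⟩ := exists_extensive ht
  obtain ⟨T₂, i, _, hT₂, hi⟩ := exists_torsion (Y := Y) (cokernel j)
  let p := cokernel.π j ≫ cokernel.π i
  let a : cokernel t ⟶ kernel p := kernel.lift p j (by simp [p])
  have haj : a ≫ kernel.ι p = j := kernel.lift_ι _ _ _
  have ha : Mono a := mono_of_mono_fac haj
  refine ⟨kernel p, cokernel.π t ≫ a, Y.isoModSerre.comp_mem _ _ ?_ ?_, ?_⟩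
  · refine Y.isoModSerre_of_epi _ ?_
    have hm : Mono (Abelian.monoLift t (kernel.ι (cokernel.π t)) (kernel.condition _)) :=
      mono_monoLift t _ _
    exact Y.prop_of_mono (Abelian.monoLift t (kernel.ι (cokernel.π t)) (kernel.condition _)) hT
  · refine Y.isoModSerre_of_mono _ ?_
    have w : a ≫ kernel.ι p ≫ cokernel.π j = 0 := by rw [reassoc_of% haj, cokernel.condition]
    let S := ShortComplex.mk a (kernel.ι p ≫ cokernel.π j) w
    have hS : S.Exact := by
      refine S.exact_of_f_is_kernel (KernelFork.IsLimit.ofι' a w (fun {A} x hx => ?_))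
      rw [← Category.assoc] at hx
      refine ⟨Abelian.monoLift j (x ≫ kernel.ι p) hx, ?_⟩
      rw [← cancel_mono (kernel.ι p), Category.assoc, haj, Abelian.monoLift_comp]
    have hd : Mono (cokernel.desc a (kernel.ι p ≫ cokernel.π j) w) := hS.mono_cokernelDesc
    have hd0 : cokernel.desc a (kernel.ι p ≫ cokernel.π j) w ≫ cokernel.π i = 0 := by
      rw [← cancel_epi (cokernel.π a), cokernel.π_desc_assoc, comp_zero, Category.assoc]
      exact kernel.condition p
    have hm : Mono (Abelian.monoLift i _ hd0) :=
      mono_monoLift i _ hd0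
    exact Y.prop_of_mono (Abelian.monoLift i _ hd0) hT₂
  · refine (hE.of_mono (kernel.ι p)).isLocal ?_
    intro A B s _ hs g
    obtain ⟨h, hh⟩ := hE' s hs (g ≫ kernel.ι p)
    have h0 : s ≫ h ≫ p = 0 := by rw [reassoc_of% hh, kernel.condition, comp_zero]
    have h1 : h ≫ p = 0 := by
      rw [← cokernel.π_desc s (h ≫ p) h0, hi.eq_zero hs (cokernel.desc s (h ≫ p) h0), comp_zero]
    refine ⟨kernel.lift p h h1, ?_⟩
    rw [← cancel_mono (kernel.ι p), Category.assoc, kernel.lift_ι, hh]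

variable {D : Type u'} [Category.{v'} D]

lemma isLocal_map_bijective [IsLocalizing Y] (π : C ⥤ D) [π.IsLocalization Y.isoModSerre]
    {N : C} (hN : Y.isoModSerre.isLocal N) (A : C) :
    Function.Bijective (fun f : A ⟶ N => π.map f) := by
  constructor
  · intro f g hfg
    obtain ⟨A', s, hs, h⟩ := (MorphismProperty.map_eq_iff_precomp π Y.isoModSerre f g).1 hfg
    exact (hN s hs).1 h
  · intro f
    obtain ⟨φ, hφ⟩ := Localization.exists_rightFraction π Y.isoModSerre f
    obtain ⟨h, hh⟩ := (hN φ.s φ.hs).2 φ.f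
    have := Localization.inverts π Y.isoModSerre φ.s φ.hs
    refine ⟨h, ?_⟩
    change π.map h = f
    rw [hφ, ← cancel_epi (π.map φ.s), φ.map_s_comp_map, ← π.map_comp]
    exact congrArg π.map hh

/-- The quotient functor `π : C ⥤ C/Y` has a right adjoint. -/
theorem isLeftAdjoint_of_isLocalization (Y : ObjectProperty C) [IsLocalizing Y] (π : C ⥤ D)
    [π.IsLocalization Y.isoModSerre] : π.IsLeftAdjoint := by
  apply Functor.isLeftAdjoint_of_rightAdjointObjIsDefined_eq_top
  ext X
  simp only [Pi.top_apply, Prop.top_eq_true, iff_true]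
  have := Localization.essSurj π Y.isoModSerre
  obtain ⟨N, u, hu, hN⟩ := exists_local (Y := Y) (π.objPreimage X)
  have := Localization.inverts π Y.isoModSerre u hu
  let e : π.obj N ≅ X := (asIso (π.map u)).symm ≪≫ π.objObjPreimageIso X
  let ρ : (π.op ⋙ yoneda.obj X).RepresentableBy N :=
    { homEquiv {A} := (Equiv.ofBijective _ (isLocal_map_bijective π hN A)).trans
        (Iso.homToEquiv e)
      homEquiv_comp f g := by simp [Iso.homToEquiv] }
  exact ρ.isRepresentable

end SectionFunctor

section EssentiallyStable

variable {C : Type u} [Category.{v} C] [Abelian C] [IsGrothendieckAbelian.{v} C]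
  {D : Type u'} [Category.{v'} D]

/-- The section functor `ω : C/Y ⥤ C`, right adjoint to the quotient functor `π : C ⥤ C/Y`. -/
noncomputable def sectionFunctor (Y : ObjectProperty C) [IsLocalizing Y] (π : C ⥤ D)
    [π.IsLocalization Y.isoModSerre] : D ⥤ C :=
  haveI := isLeftAdjoint_of_isLocalization Y π
  π.rightAdjoint

/-- The adjunction between the quotient functor and the section functor. -/
noncomputable def sectionAdjunction (Y : ObjectProperty C) [IsLocalizing Y] (π : C ⥤ D)
    [π.IsLocalization Y.isoModSerre] : π ⊣ sectionFunctor Y π :=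
  haveI := isLeftAdjoint_of_isLocalization Y π
  Adjunction.ofIsLeftAdjoint π

/-- `Z` is `Y`-essentially stable if `ω (π M)` is in `Z` for every `M` in `Z`. -/
def IsEssentiallyStable (Y : ObjectProperty C) [IsLocalizing Y] (π : C ⥤ D)
    [π.IsLocalization Y.isoModSerre] (Z : ObjectProperty C) : Prop :=
  ∀ ⦃M : C⦄, Z M → Z ((sectionFunctor Y π).obj (π.obj M))

end EssentiallyStable

end QuotientCat

namespace QuotientCat

/-! ### Extensions and the Gabriel product -/

section GabrielProduct

variable {C : Type u} [Category.{v} C] [Abelian C]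

/-! Everything rests on the unit `M ⟶ ωπM`: its kernel and cokernel lie in `Y`, and `ωπM` is
torsionfree (`isoModSerre_unit_and_isTorsionfree`). So a torsionfree `M` with `πM ≅ πN`, `N` in `Z`,
embeds into `ωπN`. Intersecting `M` with the image of `N` shows `M ∈ Y * Z`. Conversely `Y * Z ⊆
π⁻¹(π(Z))`, since `π` inverts monomorphisms with cokernel in `Y`. The two classes thus have the same
torsionfree objects, which is the first claim.

For the equivalences: if `Z` is stable, the embedding `M ⟶ ωπN` puts `M` in `Z`. If the torsionfree
parts agree and `P ∈ Y * Z`, then `P` modulo its torsion lies in `Z' ⊆ Z`, so `P ∈ Z * Y`. If `Y * Z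
⊆ Z * Y`, then `ωπM`, which is in `Y * Z`, is in `Z * Y`; being torsionfree, it is in `Z`. -/

lemma gabrielProduct_of_mono {V W : ObjectProperty C} {M P : C} (f : M ⟶ P) [Mono f]
    (hM : W M) (hf : V (cokernel f)) : gabrielProduct V W P :=
  ⟨M, cokernel f, f, cokernel.π f, cokernel.condition f,
    { exact := ShortComplex.exact_cokernel f
      mono_f := inferInstanceAs (Mono f)
      epi_g := inferInstanceAs (Epi (cokernel.π f)) }, hM, hf⟩

lemma gabrielProduct_of_epi {V W : ObjectProperty C} {P N : C} (g : P ⟶ N) [Epi g]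
    (hg : W (kernel g)) (hN : V N) : gabrielProduct V W P :=
  ⟨kernel g, N, kernel.ι g, g, kernel.condition g,
    { exact := ShortComplex.exact_kernel g
      mono_f := inferInstanceAs (Mono (kernel.ι g))
      epi_g := inferInstanceAs (Epi g) }, hg, hN⟩

/-- The subobject in `Y` vanishes, so the projection onto the quotient in `Z` is an isomorphism. -/
lemma prop_of_gabrielProduct_of_isTorsionfree {Y Z : ObjectProperty C}
    [Z.IsClosedUnderIsomorphisms] {P : C} (h : gabrielProduct Z Y P) (hP : IsTorsionfree Y P) :
    Z P := by
  obtain ⟨M, N, f, g, w, hS, hM, hN⟩ := h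
  have : Mono f := hS.mono_f
  have : Epi g := hS.epi_g
  have : Mono g := hS.exact.mono_g ((hP f hM).eq_of_src _ _)
  have : IsIso g := isIso_of_mono_of_epi g
  exact Z.prop_of_iso (asIso g).symm hN

lemma exists_isoModSerre_of_gabrielProduct {Y Z : ObjectProperty C} [IsLocalizing Y] {P : C}
    (h : gabrielProduct Y Z P) : ∃ (M : C) (f : M ⟶ P), Z M ∧ Y.isoModSerre f := by
  obtain ⟨M, N, f, g, w, hS, hM, hN⟩ := h
  have : Mono f := hS.mono_f
  have : Epi g := hS.epi_g
  exact ⟨M, f, hM, Y.isoModSerre_of_mono f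
    (Y.prop_of_iso (IsColimit.coconePointUniqueUpToIso hS.gIsCokernel (colimit.isColimit _)) hN)⟩

/-- If `M` embeds into an object `E` receiving a morphism from `N` in `Z` with cokernel in `Y`,
then `M` is an extension of an object in `Y` by the intersection of `M` with the image of `N`. -/
lemma gabrielProduct_of_mono_of_cokernel {Y Z : ObjectProperty C} [IsLocalizing Y]
    [IsWeaklyClosed Z] {M N E : C} (g : M ⟶ E) [Mono g] (f : N ⟶ E) (hN : Z N)
    (hf : Y (cokernel f)) : gabrielProduct Y Z M := by
  -- The kernel of `q` is the intersection of `M` with the image of `f`; it embeds into that image,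
  -- a quotient of `N`.
  let q := g ≫ cokernel.π f
  have hq : (kernel.ι q ≫ g) ≫ cokernel.π f = 0 := by
    rw [Category.assoc, kernel.condition]
  have : Mono (kernel.lift (cokernel.π f) (kernel.ι q ≫ g) hq ≫ kernel.ι (cokernel.π f)) := by
    rw [kernel.lift_ι]; infer_instance
  have : Mono (kernel.lift (cokernel.π f) (kernel.ι q ≫ g) hq) := mono_of_mono _
    (kernel.ι (cokernel.π f))
  have hI : Z (Abelian.image f) := Z.prop_of_epi (Abelian.factorThruImage f) hN
  exact gabrielProduct_of_mono (kernel.ι q)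
    (Z.prop_of_mono (kernel.lift (cokernel.π f) (kernel.ι q ≫ g) hq) hI)
    -- The cokernel of `kernel.ι q` is the coimage of `q`, which embeds into `cokernel f`.
    (Y.prop_of_mono (Abelian.factorThruCoimage q) hf)

end GabrielProduct

/-! ### Subcategories generated by torsionfree objects -/

section GeneratedBy

variable {C : Type u} [Category.{v} C] [HasCoproducts.{v} C]

lemma generatedBy_mono {P Q : ObjectProperty C} (h : P ≤ Q) : generatedBy P ≤ generatedBy Q := by
  rintro M ⟨ι, K, f, hK, hf⟩
  exact ⟨ι, K, f, fun i => h _ (hK i), hf⟩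

lemma le_generatedBy (P : ObjectProperty C) : P ≤ generatedBy P := fun M hM =>
  ⟨PUnit, fun _ => M, Sigma.desc fun _ => 𝟙 M, fun _ => hM,
    epi_of_epi_fac (Sigma.ι_desc (fun _ => 𝟙 M) PUnit.unit)⟩

/-- Only the torsionfree objects of `V` serve as generators, so the inclusion is needed only on
them. -/
lemma torsionfreePart_mono (Y : ObjectProperty C) {V W : ObjectProperty C}
    (h : ∀ M, V M → IsTorsionfree Y M → W M) : torsionfreePart Y V ≤ torsionfreePart Y W :=
  generatedBy_mono fun M hM => ⟨h M hM.1 hM.2, hM.2⟩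

variable [Abelian C]

lemma torsionfreePart_le (Y Z : ObjectProperty C) [IsWeaklyClosed Z] :
    torsionfreePart Y Z ≤ Z := by
  rintro M ⟨ι, K, f, hK, hf⟩
  exact Z.prop_of_epi f (IsWeaklyClosed.prop_sigma Z K fun i => (hK i).1)

end GeneratedBy

/-! ### The unit of the adjunction and the comparison of subcategories -/

section LocalObjects

variable {C : Type u} [Category.{v} C] [Abelian C] {Y : ObjectProperty C} [IsLocalizing Y]

open ZeroObject in
-- For `T` in `Y` the map `T ⟶ 0` is an isomorphism modulo `Y`, so by locality every `T ⟶ N` factors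
-- through `0`.
lemma isTorsionfree_of_isLocal {N : C} (hN : Y.isoModSerre.isLocal N) : IsTorsionfree Y N := by
  intro T i _ hT
  have h0 : Y.isoModSerre (0 : T ⟶ 0) := Y.isoModSerre_of_epi _ (Y.prop_of_mono (kernel.ι _) hT)
  obtain ⟨g, hg⟩ := (hN (0 : T ⟶ 0) h0).2 i
  exact IsZero.of_mono_eq_zero i (hg.symm.trans zero_comp)

lemma IsTorsionfree.mono_of_prop_kernel {M N : C} (hM : IsTorsionfree Y M) (f : M ⟶ N)
    (hf : Y (kernel f)) : Mono f :=
  Preadditive.mono_of_kernel_zero (hM.eq_zero hf (kernel.ι f))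

variable {D : Type u'} [Category.{v'} D] (π : C ⥤ D) [π.IsLocalization Y.isoModSerre]

lemma inverseImage_map_of_gabrielProduct {Z : ObjectProperty C} {P : C}
    (h : gabrielProduct Y Z P) :
    (Z.map π).inverseImage π P := by
  obtain ⟨M, f, hM, hf⟩ := exists_isoModSerre_of_gabrielProduct h
  have := Localization.inverts π Y.isoModSerre f hf
  exact ⟨M, hM, ⟨asIso (π.map f)⟩⟩

variable [IsGrothendieckAbelian.{v} C]

/-- By Yoneda: composing with the unit is the bijection `f ↦ π.map f` into a local object followed
by the adjunction bijection. -/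
lemma isIso_unit_of_isLocal {N : C} (hN : Y.isoModSerre.isLocal N) :
    IsIso ((sectionAdjunction Y π).unit.app N) := by
  rw [isIso_iff_yoneda_map_bijective]
  intro A
  have h := ((sectionAdjunction Y π).homEquiv A (π.obj N)).bijective.comp
    (isLocal_map_bijective π hN A)
  have hc : (sectionAdjunction Y π).homEquiv A (π.obj N) ∘ (fun f : A ⟶ N => π.map f) =
      fun f => f ≫ (sectionAdjunction Y π).unit.app N := by
    funext f
    simp [Adjunction.homEquiv_unit]
  rwa [hc] at h

variable (Y) in
-- Both properties are transported from a map `u : M ⟶ N` to a local object: `N ≅ ωπN ≅ ωπM`, and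
-- naturality of the unit identifies `u` with the unit at `M`.
lemma isoModSerre_unit_and_isTorsionfree (M : C) :
    Y.isoModSerre ((sectionAdjunction Y π).unit.app M) ∧
      IsTorsionfree Y ((sectionFunctor Y π).obj (π.obj M)) := by
  obtain ⟨N, u, hu, hN⟩ := exists_local (Y := Y) M
  have := isIso_unit_of_isLocal π hN
  have := Localization.inverts π Y.isoModSerre u hu
  let e : N ≅ (sectionFunctor Y π).obj (π.obj M) :=
    asIso ((sectionAdjunction Y π).unit.app N) ≪≫
      (sectionFunctor Y π).mapIso (asIso (π.map u)).symm
  have he : u ≫ e.hom = (sectionAdjunction Y π).unit.app M := by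
    simp only [e, Iso.trans_hom, asIso_hom, Functor.mapIso_hom, Iso.symm_hom, asIso_inv]
    rw [← Category.assoc, ← (sectionAdjunction Y π).unit_naturality u, Category.assoc,
      ← Functor.map_comp, IsIso.hom_inv_id, CategoryTheory.Functor.map_id, Category.comp_id]
  refine ⟨?_, (isTorsionfree_of_isLocal hN).of_mono e.inv⟩
  rw [← he]
  exact Y.isoModSerre.comp_mem _ _ hu (Y.isoModSerre.of_isIso e.hom)

variable (Y) in
/-- A morphism from a torsionfree object `M` to `ω (π N)` which is a monomorphism, given an
isomorphism between the images of `M` and `N` in the quotient category. -/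
lemma exists_mono_section {M N : C} (hM : IsTorsionfree Y M) (e : π.obj N ≅ π.obj M) :
    ∃ g : M ⟶ (sectionFunctor Y π).obj (π.obj N), Mono g := by
  have := hM.mono_of_prop_kernel _ (isoModSerre_unit_and_isTorsionfree Y π M).1.1
  exact ⟨(sectionAdjunction Y π).unit.app M ≫ (sectionFunctor Y π).map e.inv, inferInstance⟩

variable {Z : ObjectProperty C} [IsWeaklyClosed Z]

lemma gabrielProduct_of_inverseImage_map {M : C} (h : (Z.map π).inverseImage π M)
    (hM : IsTorsionfree Y M) : gabrielProduct Y Z M := by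
  obtain ⟨N, hN, ⟨e⟩⟩ := h
  obtain ⟨g, _⟩ := exists_mono_section Y π hM e
  exact gabrielProduct_of_mono_of_cokernel g ((sectionAdjunction Y π).unit.app N) hN
    (isoModSerre_unit_and_isTorsionfree Y π N).1.2

lemma torsionfreePart_eq_of_isEssentiallyStable (h : IsEssentiallyStable Y π Z) :
    torsionfreePart Y Z = torsionfreePart Y ((Z.map π).inverseImage π) := by
  refine le_antisymm (torsionfreePart_mono Y fun M hM _ => ⟨M, hM, ⟨Iso.refl _⟩⟩)
    (torsionfreePart_mono Y ?_)
  rintro M ⟨N, hN, ⟨e⟩⟩ hM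
  obtain ⟨g, _⟩ := exists_mono_section Y π hM e
  exact Z.prop_of_mono g (h hN)

lemma gabrielProduct_le_of_torsionfreePart_eq
    (h : torsionfreePart Y Z = torsionfreePart Y ((Z.map π).inverseImage π)) :
    gabrielProduct Y Z ≤ gabrielProduct Z Y := by
  intro P hP
  obtain ⟨T, i, _, hT, hi⟩ := exists_torsion (Y := Y) P
  have : Mono (Abelian.monoLift i (kernel.ι (cokernel.π i)) (kernel.condition _)) :=
    mono_monoLift i _ _
  have hK : Y (kernel (cokernel.π i)) :=
    Y.prop_of_mono (Abelian.monoLift i (kernel.ι (cokernel.π i)) (kernel.condition _)) hT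
  refine gabrielProduct_of_epi (cokernel.π i) hK (torsionfreePart_le Y Z _ ?_)
  rw [h]
  have := Localization.inverts π Y.isoModSerre _ (Y.isoModSerre_of_epi (cokernel.π i) hK)
  obtain ⟨M, hM, ⟨e⟩⟩ := inverseImage_map_of_gabrielProduct π hP
  -- The quotient of `P` by its torsion is torsionfree and has the same image under `π` as `P`.
  exact le_generatedBy _ _ ⟨⟨M, hM, ⟨e ≪≫ asIso (π.map (cokernel.π i))⟩⟩, hi⟩

lemma isEssentiallyStable_of_gabrielProduct_le
    (h : gabrielProduct Y Z ≤ gabrielProduct Z Y) : IsEssentiallyStable Y π Z := by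
  intro M hM
  obtain ⟨hη, hE⟩ := isoModSerre_unit_and_isTorsionfree Y π M
  exact prop_of_gabrielProduct_of_isTorsionfree
    -- With the identity as embedding, the cokernel of the unit being in `Y` puts all of `ωπM` in `Y
    -- * Z`.
    (h _ (gabrielProduct_of_mono_of_cokernel (𝟙 _) _ hM hη.2)) hE

end LocalObjects

end QuotientCat

theorem proposition4p6 {C : Type u} [Category.{v} C] [Abelian C] [IsGrothendieckAbelian.{v} C]
    (Y : ObjectProperty C) [QuotientCat.IsLocalizing Y] (Z : ObjectProperty C) [QuotientCat.IsWeaklyClosed Z]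
    {D : Type u'} [Category.{v'} D] (π : C ⥤ D) [π.IsLocalization Y.isoModSerre] :
    QuotientCat.torsionfreePart Y ((Z.map π).inverseImage π) = QuotientCat.torsionfreePart Y (QuotientCat.gabrielProduct Y Z) ∧
    [QuotientCat.IsEssentiallyStable Y π Z,
      QuotientCat.torsionfreePart Y Z = QuotientCat.torsionfreePart Y ((Z.map π).inverseImage π),
      QuotientCat.gabrielProduct Y Z ≤ QuotientCat.gabrielProduct Z Y].TFAE := by
  refine ⟨le_antisymm
    (QuotientCat.torsionfreePart_mono Y fun M hM hM' =>
      QuotientCat.gabrielProduct_of_inverseImage_map π hM hM')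
    (QuotientCat.torsionfreePart_mono Y fun M hM _ =>
      QuotientCat.inverseImage_map_of_gabrielProduct π hM), ?_⟩
  tfae_have 1 → 2 := QuotientCat.torsionfreePart_eq_of_isEssentiallyStable π
  tfae_have 2 → 3 := QuotientCat.gabrielProduct_le_of_torsionfreePart_eq π
  tfae_have 3 → 1 := QuotientCat.isEssentiallyStable_of_gabrielProduct_le π
  tfae_finish
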